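/- Let $d\in\mathbb N$, $d\ge 1$, and $\hat g(\xi)=\int_{\mathbb R^d} g(x)e^{-2\pi i\langle x,\xi\rangle}\,dx$ (extended to a unitary operator on $L^2(\mathbb R^d)$). Let $\chi\in L^1(\mathbb R^d)\cap L^2(\mathbb R^d)$ and let $\Psi=(\psi_i)_{i\in I}$ be a countable family in $L^1(\mathbb R^d)\cap L^2(\mathbb R^d)$ such that $$|\hat\chi(\xi)|^2+\sum_{i\in I}|\hat\psi_i(\xi)|^2=1\qquad\text{for a.e. }\xi\in\mathbb R^d .$$ For $f\in L^2(\mathbb R^d)$ and a path $p=(\psi_{i_1},\dots,\psi_{i_N})$ put $U[p]f=|\cdots||f*\psi_{i_1}|*\psi_{i_2}|\cdots*\psi_{i_N}|$ (and $U[p]f=f$ if $N=0$), and let $$W_N(f)=\sum_{p\in\Psi^N}\|U[p]f\|_2^2\in[0,\infty].$$ **Assumption 1.** Let $\kappa\ge 2$ be an integer, $(r_j)_{j\in\mathbb N}$ a strictly increasing sequence of positive reals with $\gamma:=\inf_{j} r_j/r_{j+\kappa}>0$, and $\rho\in[0,1)$. Let $\nu^*=(1/\sqrt d,\dots,1/\sqrt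 d)$ and $H^\rho=\{x\in\mathbb R^d: x_k\ge 0\ \forall k,\ \langle x,\nu^*\rangle\ge(1-\rho)\|x\|_2\}$. There is a partition $\Psi=\bigcup_{j\in\mathbb N}\Psi_j$ such that for every $j$ and every $\psi\in\Psi_j$ there is an orthogonal matrix $A_\psi$ with $$\operatorname{supp}(\hat\psi)\subseteq A_\psi H^\rho\cap\{\xi: r_j\le\|\xi\|_2\le r_{j+\kappa}\}.$$ Suppose that Assumption 1 holds and let $$\alpha:=\sqrt{1-\frac{4\gamma}{(1+\gamma)^2}(1-\rho)^2}.$$ Then $\alpha\in(0,1)$, and for every $s>0$: (a) if $f\in H^s(\mathbb R^d)$, i.e. $f\in L^2(\mathbb R^d)$ and $(1+\|\cdot\|_2^2)^{s/2}\hat f\in L^2(\mathbb R^d)$, then $W_N(f)=O(\alpha^{2\min\{s,1\}N})$; (b) if $f\in H^s_{\log}(\mathbb R^d)$, i.e. $f\in L^2(\mathbb R^d)$ and $\ln^s(e+\|\cdot\|_2)\hat f\in L^2(\mathbb R^d)$, then $W_N(f)=O(N^{-2s})$. Here $W_N=O(E_N)$ means that there are $C>0$ and $N_0\in\mathbb N$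 with $W_N\le C E_N$ for all $N\ge N_0$; $C$ and $N_0$ may depend on $f$, $s$ and the filters. -/

import Mathlib

open MeasureTheory Set
open scoped FourierTransform ENNReal Convolution

noncomputable section

/-- The space `ℝ^d` with its Euclidean norm. -/
abbrev RSpace (d : ℕ) : Type := EuclideanSpace ℝ (Fin d)

/-! ### Scattering propagators and the energy remainder -/

/-- The single step scattering propagator `U[ψ] f = |f * ψ|`. -/
def singleStep {d : ℕ} (ψ f : RSpace d → ℂ) : RSpace d → ℂ :=
  fun x => ((‖(f ⋆[ContinuousLinearMap.mul ℂ ℂ, volume] ψ) x‖ : ℝ) : ℂ)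

/-- The scattering propagator `U[p] f = U[ψ_N] ⋯ U[ψ_1] f` along the path `p = (ψ_1, …, ψ_N)`
(the entry `ψ_1` is `p 0`); along the empty path it is the identity. -/
def scatteringPropagator {d : ℕ} :
    (N : ℕ) → (Fin N → RSpace d → ℂ) → (RSpace d → ℂ) → (RSpace d → ℂ)
  | 0, _, f => f
  | N + 1, p, f => scatteringPropagator N (Fin.tail p) (singleStep (p 0) f)

/-- The energy remainder `W_N[Ψ](f) = ∑_{p ∈ Ψ^N} ‖U[p] f‖₂²` of the filters
`Ψ = (ψ_i)_{i ∈ ι}`, as an extended nonnegative real number. -/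
def energyRemainder {d : ℕ} {ι : Type*} (ψ : ι → RSpace d → ℂ) (N : ℕ) (f : RSpace d → ℂ) :
    ℝ≥0∞ :=
  ∑' p : Fin N → ι, eLpNorm (scatteringPropagator N (fun k => ψ (p k)) f) 2 volume ^ 2

/-! ### Fourier-weighted spaces -/

/-- `𝓕L²_ω = {f ∈ L² : ω(‖·‖) 𝓕f ∈ L²}`, with `𝓕` the unitary Fourier transform on `L²`. -/
def fourierWeightedL2 (d : ℕ) (ω : ℝ → ℝ) : Set (Lp ℂ 2 (volume : Measure (RSpace d))) :=
  {f | MemLp (fun ξ : RSpace d =>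
    (ω ‖ξ‖ : ℂ) * (𝓕 f : Lp ℂ 2 (volume : Measure (RSpace d))) ξ) 2 volume}

/-- The fractional Sobolev space `H^s(ℝ^d)`, with weight `(1 + t²)^(s/2)`. -/
def sobolevH (d : ℕ) (s : ℝ) : Set (Lp ℂ 2 (volume : Measure (RSpace d))) :=
  fourierWeightedL2 d (fun t => (1 + t ^ 2) ^ (s / 2))

/-- The fractional Log-Sobolev space `H^s_log(ℝ^d)`, with weight `ln^s(e + t)`. -/
def logSobolevH (d : ℕ) (s : ℝ) : Set (Lp ℂ 2 (volume : Measure (RSpace d))) :=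
  fourierWeightedL2 d (fun t => Real.log (Real.exp 1 + t) ^ s)

/-! ### The assumption on the filters -/

/-- The unit vector `ν* = (1/√d, …, 1/√d)`. -/
def diagonalVector (d : ℕ) : RSpace d := WithLp.toLp 2 (fun _ => 1 / Real.sqrt d)

/-- The cone `H^ρ = {x ∈ ℝ^d_{≥ 0} : ⟨x, ν*⟩ ≥ (1 - ρ) ‖x‖}`. -/
def coneH (d : ℕ) (ρ : ℝ) : Set (RSpace d) :=
  {x | (∀ k, 0 ≤ x k) ∧ (1 - ρ) * ‖x‖ ≤ inner ℝ x (diagonalVector d)}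

/-- The closed spherical shell around `0` with inner radius `r` and outer radius `R`. -/
def shell (d : ℕ) (r R : ℝ) : Set (RSpace d) :=
  Metric.closedBall 0 R \ Metric.ball 0 r

/-- The output-generating filter `χ` and the filters `Ψ = (ψ_i)_{i ∈ ι}` lie in `L¹ ∩ L²` and
satisfy the Littlewood-Paley condition. -/
structure IsFilterBank {d : ℕ} {ι : Type*} (χ : RSpace d → ℂ) (ψ : ι → RSpace d → ℂ) :
    Prop where
  memL1_chi : MemLp χ 1 volume
  memL2_chi : MemLp χ 2 volume
  memL1 : ∀ i, MemLp (ψ i) 1 volume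
  memL2 : ∀ i, MemLp (ψ i) 2 volume
  littlewoodPaley : ∀ᵐ ξ : RSpace d ∂volume, ‖𝓕 χ ξ‖ₑ ^ 2 + ∑' i, ‖𝓕 (ψ i) ξ‖ₑ ^ 2 = 1

/-- High-pass nature and frequency localization of the filters, with overlap `κ`, scales `r`
(numbered from `0`), `γ = inf_j r_j / r_{j+κ} > 0` and angular spread `ρ`. -/
structure FilterAssumption {d : ℕ} {ι : Type*} (χ : RSpace d → ℂ) (ψ : ι → RSpace d → ℂ)
    (κ : ℕ) (r : ℕ → ℝ) (γ ρ : ℝ) : Prop where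
  filterBank : IsFilterBank χ ψ
  two_le_kappa : 2 ≤ κ
  scale_pos : ∀ j, 0 < r j
  scale_strictMono : StrictMono r
  gamma_eq : γ = ⨅ j, r j / r (j + κ)
  gamma_pos : 0 < γ
  rho_nonneg : 0 ≤ ρ
  rho_lt_one : ρ < 1
  /-- `J i` is the index `j` of the part `Ψ_j` that contains `ψ_i`, so the parts form a partition
  of the filters; `A` is an orthogonal transformation, i.e. an element of `O_d(ℝ)`. -/
  localized : ∃ J : ι → ℕ, ∀ i, ∃ A : RSpace d ≃ₗᵢ[ℝ] RSpace d,
    tsupport (𝓕 (ψ i)) ⊆ (A '' coneH d ρ) ∩ shell d (r (J i)) (r (J i + κ))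

/-- The decay factor `α(γ, ρ) = √(1 - 4γ/(1+γ)² (1-ρ)²)`. -/
def decayFactor (γ ρ : ℝ) : ℝ :=
  Real.sqrt (1 - 4 * γ / (1 + γ) ^ 2 * (1 - ρ) ^ 2)

end

/-! ### Fourier transform on `L²` and convolution. -/

section FourierL2

variable {V : Type*} [NormedAddCommGroup V] [InnerProductSpace ℝ V] [FiniteDimensional ℝ V]
  [MeasurableSpace V] [BorelSpace V]

/-! Measure high-frequency energy with the weight 1 - exp(-t‖ξ‖²). Taking the modulus after a filter
moves energy towards the origin: for a modulated Gaussian g_ν, the pointwise bound |f * g_ν| ≤ |f| *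
|g_ν| and Plancherel show that |f| has at least as much Gaussian energy around 0 as f has around any
ν. As f and |f| have the same norm, the weighted energy of |f| is at most that of f with the weight
recentered at ν (`spectralEnergy_modulus_le`).

The spectrum of f * ψ_i lies in a sector of a shell, and some ν there satisfies ‖ξ - ν‖² ≤ α²‖ξ‖²
throughout (`exists_norm_sub_sq_le`). Summing over i with Littlewood-Paley, one layer replaces t by
tα² (`FilterAssumption.tsum_spectralEnergy_singleStep_le`). In the last layer all filters vanish for
‖ξ‖ < r 0, where the weight is small, so plain energy is controlled by weighted energy. Hence
W_{N+1}(f) is at most a constant times ∫ |𝓕 f|² (1 - exp(-tα^{2N}‖ξ‖²)), and elementary bounds on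
this weight give both rates. -/

theorem Real.continuous_fourier_of_integrable {f : V → ℂ} (hf : Integrable f) :
    Continuous (𝓕 f) := by
  have := (Real.Lp.fourierTransform (memLp_one_iff_integrable.2 hf).toLp).continuous
  rwa [Real.fourierTransform_toLp] at this

theorem Real.continuous_fourierInv_of_integrable {f : V → ℂ} (hf : Integrable f) :
    Continuous (𝓕⁻ f) := by
  have := (Real.Lp.fourierTransformInv (memLp_one_iff_integrable.2 hf).toLp).continuous
  rwa [Real.Lp.fourierTransformInv_toLp] at this

theorem Real.norm_fourier_le_integral_norm (f : V → ℂ) (ξ : V) :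
    ‖𝓕 f ξ‖ ≤ ∫ x, ‖f x‖ :=
  VectorFourier.norm_fourierIntegral_le_integral_norm _ _ _ _ _

theorem Real.integral_fourier_smul_eq {f g : V → ℂ} (hf : Integrable f) (hg : Integrable g) :
    ∫ ξ, 𝓕 f ξ • g ξ = ∫ x, f x • 𝓕 g x := by
  simpa using! VectorFourier.integral_fourierIntegral_smul_eq_flip (L := innerₗ V)
    Real.continuous_fourierChar continuous_inner hf hg

theorem Real.integral_fourierInv_smul_eq {f g : V → ℂ} (hf : Integrable f) (hg : Integrable g) :
    ∫ ξ, 𝓕⁻ f ξ • g ξ = ∫ x, f x • 𝓕⁻ g x := by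
  have h := Real.integral_fourier_smul_eq hf hg.comp_neg
  rw [← integral_neg_eq_self] at h
  simpa [Real.fourierInv_eq_fourier_neg f, Real.fourierInv_eq_fourier_comp_neg g] using h

/-- Two locally integrable functions with the same integrals against Schwartz functions agree
almost everywhere. -/
theorem ae_eq_of_integral_schwartz_smul_eq {f g : V → ℂ} (hf : LocallyIntegrable f)
    (hg : LocallyIntegrable g)
    (h : ∀ u : SchwartzMap V ℂ, ∫ x, u x • f x = ∫ x, u x • g x) : f =ᵐ[volume] g := by
  refine ae_eq_of_integral_contDiff_smul_eq hf hg fun u hu huc => ?_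
  have h₁ : HasCompactSupport (Complex.ofRealCLM ∘ u) := huc.comp_left rfl
  have h₂ : ContDiff ℝ (⊤ : ℕ∞) (Complex.ofRealCLM ∘ u) := by fun_prop
  simpa using h (h₁.toSchwartzMap h₂)

/-- The `L²` Fourier transform is given by the Fourier integral on `L¹ ∩ L²`. -/
theorem MeasureTheory.MemLp.coeFn_fourier_toLp {f : V → ℂ} (h1 : Integrable f)
    (h2 : MemLp f 2) : (𝓕 (h2.toLp f) : Lp ℂ 2 (volume : Measure V)) =ᵐ[volume] 𝓕 f := by
  refine ae_eq_of_integral_schwartz_smul_eq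
    ((Lp.memLp _).locallyIntegrable (by norm_num))
    (Real.continuous_fourier_of_integrable h1).locallyIntegrable fun u => ?_
  rw [← Lp.toTemperedDistribution_apply, ← Lp.fourier_toTemperedDistribution_eq,
    TemperedDistribution.fourier_apply, Lp.toTemperedDistribution_apply,
    ← Real.integral_fourier_smul_eq u.integrable h1]
  refine integral_congr_ae ?_
  filter_upwards [h2.coeFn_toLp] with x hx
  rw [hx, SchwartzMap.fourier_coe]

/-- The inverse `L²` Fourier transform is given by the inverse Fourier integral on `L¹ ∩ L²`. -/
theorem MeasureTheory.MemLp.coeFn_fourierInv_toLp {f : V → ℂ} (h1 : Integrable f)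
    (h2 : MemLp f 2) : (𝓕⁻ (h2.toLp f) : Lp ℂ 2 (volume : Measure V)) =ᵐ[volume] 𝓕⁻ f := by
  refine ae_eq_of_integral_schwartz_smul_eq
    ((Lp.memLp _).locallyIntegrable (by norm_num))
    (Real.continuous_fourierInv_of_integrable h1).locallyIntegrable fun u => ?_
  rw [← Lp.toTemperedDistribution_apply, ← Lp.fourierInv_toTemperedDistribution_eq,
    TemperedDistribution.fourierInv_apply, Lp.toTemperedDistribution_apply,
    ← Real.integral_fourierInv_smul_eq u.integrable h1]
  refine integral_congr_ae ?_
  filter_upwards [h2.coeFn_toLp] with x hx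
  rw [hx, SchwartzMap.fourierInv_coe]

theorem MeasureTheory.MemLp.comp_sub_left {g : V → ℂ} (hg : MemLp g 2) (x : V) :
    MemLp (fun t => g (x - t)) 2 :=
  hg.comp_measurePreserving (Measure.measurePreserving_sub_left volume x)

theorem Real.fourier_star_comp_sub_left (g : V → ℂ) (x ξ : V) :
    𝓕 (fun t => star (g (x - t))) ξ = star (Real.fourierChar (inner ℝ x ξ) • 𝓕 g ξ) := by
  rw [Real.fourier_eq, Real.fourier_eq, ← integral_sub_left_eq_self _ volume x]
  simp only [Circle.smul_def, smul_eq_mul, sub_sub_cancel]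
  rw [← integral_const_mul, Complex.star_def, ← integral_conj]
  congr 1 with t
  simp only [map_mul]
  rw [← mul_assoc]
  congr 1
  rw [← map_mul, ← Circle.coe_mul, ← AddChar.map_add_eq_mul, inner_sub_left,
    ← Circle.coe_inv_eq_conj, ← AddChar.map_neg_eq_inv]
  congr 3

/-- Convolving an `L²` function with an `L¹ ∩ L²` function amounts to an inverse Fourier
integral. -/
theorem convolution_eq_fourierInv {f g : V → ℂ} (hf : MemLp f 2) (hg1 : Integrable g)
    (hg : MemLp g 2) :
    f ⋆[ContinuousLinearMap.mul ℂ ℂ, volume] g =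
      𝓕⁻ (fun ξ => 𝓕 g ξ * (𝓕 (hf.toLp f) : Lp ℂ 2 (volume : Measure V)) ξ) := by
  ext x
  -- The convolution at x is the inner product of f with t ↦ conj g(x - t), so Plancherel applies
  -- pointwise in x.
  have h2 : MemLp (fun t => star (g (x - t))) 2 := (hg.comp_sub_left x).star
  have h1 : Integrable (fun t => star (g (x - t))) :=
    memLp_one_iff_integrable.1
      (memLp_one_iff_integrable.2 ((integrable_comp_sub_left g x).2 hg1)).star
  have key := Lp.inner_fourier_eq (h2.toLp _) (hf.toLp f)
  rw [L2.inner_def, L2.inner_def] at key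
  rw [convolution_def, Real.fourierInv_eq]
  trans ∫ t, inner ℂ ((h2.toLp _ : Lp ℂ 2 (volume : Measure V)) t)
      ((hf.toLp f : Lp ℂ 2 (volume : Measure V)) t)
  · refine integral_congr_ae ?_
    filter_upwards [h2.coeFn_toLp, hf.coeFn_toLp] with t ht ht'
    rw [ht, ht']
    simp
  · rw [← key]
    refine integral_congr_ae ?_
    filter_upwards [h2.coeFn_fourier_toLp h1] with ξ hξ
    rw [hξ, Real.fourier_star_comp_sub_left]
    simp [real_inner_comm, Circle.smul_def]
    ring

theorem fourier_mul_memLp {f g : V → ℂ} (hf : MemLp f 2) (hg1 : Integrable g) :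
    MemLp (fun ξ => 𝓕 g ξ * f ξ) 2 := by
  refine hf.of_le_mul (c := ∫ x, ‖g x‖)
    ((Real.continuous_fourier_of_integrable hg1).aestronglyMeasurable.mul hf.1)
    (Filter.Eventually.of_forall fun ξ => ?_)
  rw [norm_mul]
  gcongr
  exact Real.norm_fourier_le_integral_norm g ξ

/-- The product of the transforms is both integrable and square integrable, so its inverse Fourier
integral, which is the convolution, agrees with its inverse `L²` transform. -/
theorem exists_fourier_convolution {f g : V → ℂ} (hf : MemLp f 2) (hg1 : Integrable g)
    (hg : MemLp g 2) :
    ∃ h : MemLp (f ⋆[ContinuousLinearMap.mul ℂ ℂ, volume] g) 2,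
      (𝓕 (h.toLp _) : Lp ℂ 2 (volume : Measure V)) =ᵐ[volume]
        fun ξ => 𝓕 g ξ * (𝓕 (hf.toLp f) : Lp ℂ 2 (volume : Measure V)) ξ := by
  set F : Lp ℂ 2 (volume : Measure V) := 𝓕 (hf.toLp f)
  have hH2 : MemLp (fun ξ => 𝓕 g ξ * F ξ) 2 := fourier_mul_memLp (Lp.memLp F) hg1
  have hg' : MemLp (𝓕 g) 2 := (memLp_congr_ae (hg.coeFn_fourier_toLp hg1)).1 (Lp.memLp _)
  have hH1 : Integrable (fun ξ => 𝓕 g ξ * F ξ) := hg'.integrable_mul (Lp.memLp F)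
  have hae := hH2.coeFn_fourierInv_toLp hH1
  rw [← convolution_eq_fourierInv hf hg1 hg] at hae
  refine ⟨(memLp_congr_ae hae).1 (Lp.memLp _), ?_⟩
  have : MemLp.toLp _ ((memLp_congr_ae hae).1 (Lp.memLp _)) = 𝓕⁻ (hH2.toLp _) := by
    ext1
    exact (MemLp.coeFn_toLp _).trans hae.symm
  rw [this, FourierTransform.fourier_fourierInv_eq]
  exact hH2.coeFn_toLp

theorem eLpNorm_two_sq_eq_lintegral (f : V → ℂ) :
    eLpNorm f 2 volume ^ 2 = ∫⁻ x, ‖f x‖ₑ ^ 2 := by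
  simpa using eLpNorm_nnreal_pow_eq_lintegral (μ := volume) (f := f) (p := 2) (by norm_num)

/-- Plancherel's theorem in terms of the extended norm. -/
theorem lintegral_enorm_fourier_sq {f : V → ℂ} (hf : MemLp f 2) :
    ∫⁻ ξ, ‖(𝓕 (hf.toLp f) : Lp ℂ 2 (volume : Measure V)) ξ‖ₑ ^ 2 =
      eLpNorm f 2 volume ^ 2 := by
  rw [← eLpNorm_two_sq_eq_lintegral, ← Lp.enorm_def, ← enorm_norm, Lp.norm_fourier_eq,
    enorm_norm, Lp.enorm_def, eLpNorm_congr_ae hf.coeFn_toLp]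

end FourierL2

/-! ### The modulus moves energy to low frequencies. -/

section Modulus

variable {V : Type*} [NormedAddCommGroup V] [InnerProductSpace ℝ V] [FiniteDimensional ℝ V]
  [MeasurableSpace V] [BorelSpace V]

theorem norm_convolution_le (f g : V → ℂ) (x : V) :
    ‖(f ⋆[ContinuousLinearMap.mul ℂ ℂ, volume] g) x‖ ≤
      ‖((fun t => (‖f t‖ : ℂ)) ⋆[ContinuousLinearMap.mul ℂ ℂ, volume]
        (fun t => (‖g t‖ : ℂ))) x‖ := by
  simp only [convolution_def, ContinuousLinearMap.mul_apply']
  calc _ ≤ ∫ t, ‖f t‖ * ‖g (x - t)‖ := by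
        simpa only [norm_mul] using
          norm_integral_le_integral_norm (μ := volume) fun t => f t * g (x - t)
    _ ≤ _ := by
        simp only [← Complex.ofReal_mul]
        rw [integral_complex_ofReal, Complex.norm_real]
        exact Real.le_norm_self _

theorem MeasureTheory.MemLp.norm_ofReal {f : V → ℂ} (hf : MemLp f 2) :
    MemLp (fun x => (‖f x‖ : ℂ)) 2 :=
  hf.norm.ofReal

/-- The energy `∫ |𝓕 f|² w` of the `L²` function `f` with respect to the weight `w`. -/
noncomputable def spectralEnergy (w : V → ℝ) (f : Lp ℂ 2 (volume : Measure V)) : ℝ≥0∞ :=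
  ∫⁻ ξ, ‖(𝓕 f : Lp ℂ 2 (volume : Measure V)) ξ‖ₑ ^ 2 * ENNReal.ofReal (w ξ)

theorem eLpNorm_convolution_sq {f g : V → ℂ} (hf : MemLp f 2) (hg1 : Integrable g)
    (hg : MemLp g 2) :
    eLpNorm (f ⋆[ContinuousLinearMap.mul ℂ ℂ, volume] g) 2 volume ^ 2 =
      ∫⁻ ξ, ‖(𝓕 (hf.toLp f) : Lp ℂ 2 (volume : Measure V)) ξ‖ₑ ^ 2 * ‖𝓕 g ξ‖ₑ ^ 2 := by
  obtain ⟨h, hae⟩ := exists_fourier_convolution hf hg1 hg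
  rw [← lintegral_enorm_fourier_sq h]
  refine lintegral_congr_ae ?_
  filter_upwards [hae] with ξ hξ
  rw [hξ, enorm_mul, mul_pow, mul_comm]

/-- Modulation by ν leaves the modulus unchanged and translates the spectrum to ν. The factor c does
not depend on ν, so it cancels when two centers are compared. -/
theorem exists_modulated_gaussian {t : ℝ} (ht : 0 < t) : ∃ c : ℝ≥0∞, c ≠ 0 ∧ c ≠ ⊤ ∧
    ∃ g : V → V → ℂ, (∀ ν, Integrable (g ν)) ∧ (∀ ν, MemLp (g ν) 2) ∧
      (∀ ν x, (‖g ν x‖ : ℂ) = g 0 x) ∧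
      ∀ ν ξ, ‖𝓕 (g ν) ξ‖ₑ ^ 2 = c * ENNReal.ofReal (Real.exp (-(t * ‖ξ - ν‖ ^ 2))) := by
  -- The squared transform of exp(-b‖v‖²) decays like exp(-2π²‖ξ‖²/b), which fixes b.
  obtain ⟨b, hb, hbt⟩ : ∃ b : ℝ, 0 < b ∧ t = 2 * Real.pi ^ 2 / b :=
    ⟨2 * Real.pi ^ 2 / t, by positivity, by field_simp⟩
  let g : V → V → ℂ := fun ν v =>
    Complex.exp (-(b : ℂ) * ‖v‖ ^ 2 + 2 * Real.pi * Complex.I * (inner ℝ ν v : ℝ))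
  have hnorm : ∀ ν x, ‖g ν x‖ = Real.exp (-b * ‖x‖ ^ 2) := fun ν x => by
    simp only [g]
    rw [Complex.norm_exp]
    congr 1
    simp [← Complex.ofReal_pow]
  have hint : ∀ ν, Integrable (g ν) := fun ν =>
    GaussianFourier.integrable_cexp_neg_mul_sq_norm_add (by simpa using hb) _ _
  refine ⟨‖((Real.pi : ℂ) / b) ^ (Module.finrank ℝ V / 2 : ℂ)‖ₑ ^ 2, ?_, by simp, g, hint, ?_, ?_,
    ?_⟩
  · refine pow_ne_zero _ (enorm_ne_zero.2 ?_)
    rw [Ne, Complex.cpow_eq_zero_iff]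
    simp [hb.ne', Real.pi_ne_zero]
  · intro ν
    refine (memLp_two_iff_integrable_sq_norm (hint ν).1).2
      ((hint ν).norm.mono' ((hint ν).1.norm.pow 2) (Filter.Eventually.of_forall fun x => ?_))
    rw [Real.norm_of_nonneg (by positivity)]
    refine pow_le_of_le_one (norm_nonneg _) ?_ two_ne_zero
    rw [hnorm, Real.exp_le_one_iff]
    nlinarith [sq_nonneg ‖x‖]
  · intro ν x
    rw [hnorm]
    simp [g]
  · intro ν ξ
    have := fourier_gaussian_innerProductSpace' (b := (b : ℂ)) (by simpa using hb) ν ξ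
    rw [show 𝓕 (g ν) ξ = _ from this, enorm_mul, mul_pow]
    congr 1
    rw [← ofReal_norm, Complex.norm_exp, ← ENNReal.ofReal_pow (Real.exp_nonneg _),
      ← Real.exp_nat_mul]
    congr 2
    rw [show -(Real.pi : ℂ) ^ 2 * ‖ν - ξ‖ ^ 2 / b = ((-Real.pi ^ 2 * ‖ν - ξ‖ ^ 2 / b : ℝ) : ℂ) by
      push_cast; ring, Complex.ofReal_re, hbt, norm_sub_rev]
    push_cast
    ring

/-- Up to the factor c, the two sides are the energies of f * g_ν and |f| * g_0, and the second
function dominates the first pointwise because |g_ν| = g_0. -/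
theorem spectralEnergy_exp_le_of_modulus {f : V → ℂ} (hf : MemLp f 2) {t : ℝ}
    (ht : 0 < t) (ν : V) :
    spectralEnergy (fun ξ => Real.exp (-(t * ‖ξ - ν‖ ^ 2))) (hf.toLp f) ≤
      spectralEnergy (fun ξ => Real.exp (-(t * ‖ξ‖ ^ 2))) (hf.norm_ofReal.toLp _) := by
  obtain ⟨c, hc0, hct, g, hg1, hg2, hgn, hgF⟩ := exists_modulated_gaussian (V := V) ht
  have h1 := eLpNorm_convolution_sq hf (hg1 ν) (hg2 ν)
  have h2 := eLpNorm_convolution_sq hf.norm_ofReal (hg1 0) (hg2 0)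
  have h3 : eLpNorm (f ⋆[ContinuousLinearMap.mul ℂ ℂ, volume] g ν) 2 volume ^ 2 ≤
      eLpNorm ((fun t => (‖f t‖ : ℂ)) ⋆[ContinuousLinearMap.mul ℂ ℂ, volume] g 0) 2 volume ^ 2 := by
    gcongr
    refine eLpNorm_mono fun x => (norm_convolution_le f (g ν) x).trans_eq ?_
    simp only [hgn]
  rw [h1, h2] at h3
  simp only [hgF, mul_left_comm _ c, lintegral_const_mul' c _ hct, sub_zero] at h3
  exact (ENNReal.mul_le_mul_iff_right hc0 hct).1 h3

theorem spectralEnergy_add {w₁ w₂ : V → ℝ} (hw₁ : Measurable w₁)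
    (h₁ : 0 ≤ w₁) (h₂ : 0 ≤ w₂) (f : Lp ℂ 2 (volume : Measure V)) :
    spectralEnergy w₁ f + spectralEnergy w₂ f = spectralEnergy (w₁ + w₂) f := by
  have hm : AEMeasurable (fun ξ => ‖(𝓕 f : Lp ℂ 2 (volume : Measure V)) ξ‖ₑ ^ 2) volume :=
    (Lp.aestronglyMeasurable _).enorm.pow_const 2
  unfold spectralEnergy
  have hm₁ : AEMeasurable (fun ξ => ‖(𝓕 f : Lp ℂ 2 (volume : Measure V)) ξ‖ₑ ^ 2 *
      ENNReal.ofReal (w₁ ξ)) volume := hm.mul (by fun_prop)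
  rw [← lintegral_add_left' hm₁]
  refine lintegral_congr fun ξ => ?_
  rw [Pi.add_apply, ENNReal.ofReal_add (h₁ ξ) (h₂ ξ), mul_add]

theorem spectralEnergy_one {f : V → ℂ} (hf : MemLp f 2) :
    spectralEnergy 1 (hf.toLp f) = eLpNorm f 2 volume ^ 2 := by
  simp [spectralEnergy, lintegral_enorm_fourier_sq hf]

/-- Passing to the modulus moves spectral energy towards the origin, wherever it was centered. -/
theorem spectralEnergy_modulus_le {f : V → ℂ} (hf : MemLp f 2) {t : ℝ} (ht : 0 < t) (ν : V) :
    spectralEnergy (fun ξ => 1 - Real.exp (-(t * ‖ξ‖ ^ 2))) (hf.norm_ofReal.toLp _) ≤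
      spectralEnergy (fun ξ => 1 - Real.exp (-(t * ‖ξ - ν‖ ^ 2))) (hf.toLp f) := by
  have key : ∀ {F : V → ℂ} (hF : MemLp F 2) (μ : V),
      spectralEnergy (fun ξ => Real.exp (-(t * ‖ξ - μ‖ ^ 2))) (hF.toLp F) +
        spectralEnergy (fun ξ => 1 - Real.exp (-(t * ‖ξ - μ‖ ^ 2))) (hF.toLp F) =
        eLpNorm F 2 volume ^ 2 := fun hF μ => by
    rw [spectralEnergy_add (by fun_prop) (fun ξ => (Real.exp_pos _).le), ← spectralEnergy_one hF]
    · congr 1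
      ext ξ
      simp
    · intro ξ
      simp only [Pi.zero_apply, sub_nonneg, Real.exp_le_one_iff, Left.neg_nonpos_iff]
      positivity
  -- Since f and |f| have equal total energy, the inequality between Gaussian energies reverses for
  -- the complements; finiteness allows the cancellation.
  have hn : eLpNorm (fun x => (‖f x‖ : ℂ)) 2 volume = eLpNorm f 2 volume :=
    eLpNorm_congr_norm_ae (by simp)
  have h0 := key hf.norm_ofReal 0
  rw [hn, ← key hf ν] at h0
  simp only [sub_zero] at h0
  have hle := spectralEnergy_exp_le_of_modulus hf ht ν
  have hfin : spectralEnergy (fun ξ => Real.exp (-(t * ‖ξ - ν‖ ^ 2))) (hf.toLp f) ≠ ⊤ := by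
    refine ne_top_of_le_ne_top ?_ (le_self_add.trans_eq (key hf ν))
    exact ENNReal.pow_ne_top hf.eLpNorm_ne_top
  refine (ENNReal.add_le_add_iff_left hfin).1 ?_
  rw [← h0]
  gcongr

end Modulus

/-! ### Elementary bounds on the weight. -/

section Decay

theorem one_sub_exp_neg_le_rpow {x σ : ℝ} (hx : 0 ≤ x) (hσ : 0 < σ) (hσ1 : σ ≤ 1) :
    1 - Real.exp (-x) ≤ x ^ σ := by
  rcases le_total x 1 with h | h
  · calc _ ≤ x := by linarith [Real.add_one_le_exp (-x)]
      _ = x ^ (1 : ℝ) := (Real.rpow_one x).symm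
      _ ≤ _ := Real.rpow_le_rpow_of_exponent_ge_of_imp hx h hσ1 (by intro _ h; linarith)
  · linarith [Real.one_le_rpow h hσ.le, Real.exp_pos (-x)]

/-- Apply 1 - exp(-y) ≤ y^σ with σ = min s 1; the cap at 1 reflects the linear behavior of 1 -
exp(-y) at 0. -/
theorem one_sub_exp_le_sobolev {α s : ℝ} (hα : 0 < α) (hs : 0 < s) (n : ℕ) (x : ℝ) :
    1 - Real.exp (-(α ^ (2 * n) * x ^ 2)) ≤
      α ^ (2 * min s 1 * (n : ℝ)) * ((1 + x ^ 2) ^ (s / 2)) ^ 2 := by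
  refine (one_sub_exp_neg_le_rpow (by positivity) (lt_min hs one_pos) (min_le_right s 1)).trans ?_
  rw [Real.mul_rpow (by positivity) (by positivity), ← Real.rpow_natCast, ← Real.rpow_mul hα.le,
    ← Real.rpow_natCast (_ ^ (s / 2)), ← Real.rpow_mul (by positivity)]
  have h1 : (x ^ 2) ^ min s 1 ≤ (1 + x ^ 2) ^ (s / 2 * (2 : ℕ)) :=
    calc (x ^ 2) ^ min s 1 ≤ (1 + x ^ 2) ^ min s 1 :=
          Real.rpow_le_rpow (by positivity) (by linarith) (lt_min hs one_pos).le
      _ ≤ (1 + x ^ 2) ^ (s / 2 * (2 : ℕ)) := by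
          refine Real.rpow_le_rpow_of_exponent_le (by nlinarith [sq_nonneg x]) ?_
          push_cast
          linarith [min_le_left s 1]
  rw [show ((2 * n : ℕ) : ℝ) * min s 1 = 2 * min s 1 * n by push_cast; ring]
  gcongr

/-- Exponentially small multiples of squares are absorbed by polynomially small multiples of
powers of the logarithm. -/
theorem exists_one_sub_exp_le_logSobolev {α s : ℝ} (hα : 0 < α) (hα1 : α < 1) (hs : 0 < s) :
    ∃ K : ℝ, 0 < K ∧ ∀ (n : ℕ) (x : ℝ), 0 ≤ x →
      1 - Real.exp (-(α ^ (2 * n) * x ^ 2)) ≤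
        K * ((n : ℝ) + 1) ^ (-(2 * s)) * (Real.log (Real.exp 1 + x) ^ s) ^ 2 := by
  obtain ⟨L, hL, rfl⟩ : ∃ L : ℝ, 0 < L ∧ α = Real.exp (-L) :=
    ⟨-Real.log α, by linarith [Real.log_neg hα hα1], by rw [neg_neg, Real.exp_log hα]⟩
  -- The entry 1 serves n = 0, where u ≥ 1; the entry L/4 serves n ≥ 1, where nL/2 ≥ (n+1)L/4.
  set c := min 1 (L / 4)
  have hc : 0 < c := lt_min one_pos (by positivity)
  refine ⟨c ^ (-(2 * s)) + (2 * s / L) ^ (2 * s) * Real.exp L, by positivity, fun n x hx => ?_⟩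
  set u := Real.log (Real.exp 1 + x)
  have he : 0 < Real.exp 1 + x := by positivity
  have hu1 : 1 ≤ u := by
    rw [Real.le_log_iff_exp_le he]
    linarith
  have hxu : x ≤ Real.exp u := by
    rw [Real.exp_log he]
    linarith [Real.exp_pos 1]
  have hn : (0 : ℝ) < n + 1 := by positivity
  have husq : (u ^ s) ^ 2 = u ^ (2 * s) := by
    rw [← Real.rpow_natCast, ← Real.rpow_mul (by linarith)]
    congr 1
    push_cast
    ring
  rw [husq, add_mul, add_mul]
  have hp1 : 0 ≤ c ^ (-(2 * s)) * ((n : ℝ) + 1) ^ (-(2 * s)) * u ^ (2 * s) := by positivity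
  have hp2 : 0 ≤ (2 * s / L) ^ (2 * s) * Real.exp L * ((n : ℝ) + 1) ^ (-(2 * s)) * u ^ (2 * s) := by
    positivity
  -- For large u the logarithmic factor alone makes the right side at least 1. For small u, x ≤ exp
  -- u gives α^(2n) x² ≤ exp(2u - 2nL) ≤ exp(-nL), which beats any power of n + 1.
  rcases le_total (n * L / 2) u with h | h
  · have hcu : c * (n + 1) ≤ u := by
      rcases Nat.eq_zero_or_pos n with rfl | hpos
      · rw [Nat.cast_zero, zero_add, mul_one]
        exact (min_le_left 1 (L / 4)).trans hu1
      · have h1 : (1 : ℝ) ≤ n := by exact_mod_cast hpos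
        have h2 : c * (n + 1) ≤ L / 4 * (n + 1) := by
          gcongr
          exact min_le_right _ _
        nlinarith
    have : 1 ≤ c ^ (-(2 * s)) * ((n : ℝ) + 1) ^ (-(2 * s)) * u ^ (2 * s) := by
      rw [← Real.mul_rpow hc.le hn.le, Real.rpow_neg (by positivity), inv_mul_eq_div,
        one_le_div (by positivity)]
      exact Real.rpow_le_rpow (by positivity) hcu (by positivity)
    linarith [Real.exp_pos (-(Real.exp (-L) ^ (2 * n) * x ^ 2))]
  · have h1 : Real.exp (-L) ^ (2 * n) * x ^ 2 ≤ Real.exp (-(n * L)) :=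
      calc _ ≤ Real.exp (-L) ^ (2 * n) * Real.exp u ^ 2 := by gcongr
        _ = Real.exp (2 * u - 2 * (n * L)) := by
          rw [← Real.exp_nat_mul, ← Real.exp_nat_mul, ← Real.exp_add]
          congr 1
          push_cast
          ring
        _ ≤ _ := Real.exp_le_exp.2 (by linarith)
    -- This is y ≤ exp y at y = (n+1)L/(2s), raised to the power 2s.
    have h2 : ((n + 1) * (L / (2 * s))) ^ (2 * s) ≤ Real.exp ((n + 1) * L) := by
      calc _ ≤ Real.exp ((n + 1) * (L / (2 * s))) ^ (2 * s) := by
            gcongr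
            linarith [Real.add_one_le_exp ((n + 1) * (L / (2 * s)))]
        _ = _ := by
            rw [← Real.exp_mul]
            congr 1
            field_simp
    have h3 : Real.exp (-(n * L)) ≤
        (2 * s / L) ^ (2 * s) * Real.exp L * ((n : ℝ) + 1) ^ (-(2 * s)) := by
      rw [Real.mul_rpow hn.le (by positivity)] at h2
      rw [Real.rpow_neg hn.le, ← div_eq_mul_inv, le_div_iff₀ (by positivity)]
      have h4 : (2 * s / L) ^ (2 * s) * (L / (2 * s)) ^ (2 * s) = 1 := by
        rw [← Real.mul_rpow (by positivity) (by positivity), div_mul_div_cancel₀ hL.ne',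
          div_self (by positivity), Real.one_rpow]
      calc Real.exp (-(n * L)) * ((n : ℝ) + 1) ^ (2 * s)
          = (2 * s / L) ^ (2 * s) * Real.exp (-(n * L)) *
            (((n : ℝ) + 1) ^ (2 * s) * (L / (2 * s)) ^ (2 * s)) := by
            linear_combination (-Real.exp (-(n * L)) * ((n : ℝ) + 1) ^ (2 * s)) * h4
        _ ≤ (2 * s / L) ^ (2 * s) * Real.exp (-(n * L)) * Real.exp ((n + 1) * L) := by gcongr
        _ = _ := by
            rw [mul_assoc, ← Real.exp_add]
            congr 2
            ring
    have h5 : 1 ≤ u ^ (2 * s) := Real.one_le_rpow hu1 (by positivity)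
    have h6 := le_mul_of_one_le_right
      (show 0 ≤ (2 * s / L) ^ (2 * s) * Real.exp L * ((n : ℝ) + 1) ^ (-(2 * s)) by positivity) h5
    linarith [Real.add_one_le_exp (-(Real.exp (-L) ^ (2 * n) * x ^ 2))]

end Decay

/-! ### Geometry of the sectors and the decay factor. -/

section Localization

theorem norm_diagonalVector_le (d : ℕ) : ‖diagonalVector d‖ ≤ 1 := by
  rw [EuclideanSpace.norm_eq, ← Real.sqrt_one]
  refine Real.sqrt_le_sqrt ?_
  simp only [diagonalVector, Real.norm_eq_abs, sq_abs, div_pow, one_pow, Finset.sum_const,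
    Finset.card_univ, Fintype.card_fin, nsmul_eq_mul, Real.sq_sqrt (Nat.cast_nonneg d)]
  rw [mul_one_div]
  exact div_self_le_one _

theorem decayFactor_sq {γ ρ : ℝ} (hγ : 0 < γ) (hρ : 0 ≤ ρ) (hρ1 : ρ < 1) :
    decayFactor γ ρ ^ 2 = 1 - 4 * γ / (1 + γ) ^ 2 * (1 - ρ) ^ 2 := by
  refine Real.sq_sqrt (sub_nonneg.2 (mul_le_one₀ ?_ (by positivity) ?_))
  · rw [div_le_one (by positivity)]
    nlinarith [sq_nonneg (1 - γ)]
  · exact pow_le_one₀ (by linarith) (by linarith)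

theorem decayFactor_pos {γ ρ : ℝ} (hγ : 0 < γ) (hγ1 : γ < 1) (hρ : 0 ≤ ρ) (hρ1 : ρ < 1) :
    0 < decayFactor γ ρ := by
  refine Real.sqrt_pos.2 (sub_pos.2 (mul_lt_one_of_nonneg_of_lt_one_left (by positivity) ?_ ?_))
  · rw [div_lt_one (by positivity)]
    nlinarith [sq_pos_of_pos (sub_pos.2 hγ1)]
  · exact pow_le_one₀ (by linarith) (by linarith)

theorem decayFactor_lt_one {γ ρ : ℝ} (hγ : 0 < γ) (hρ1 : ρ < 1) : decayFactor γ ρ < 1 := by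
  have : 0 < 1 - ρ := by linarith
  rw [decayFactor, Real.sqrt_lt' one_pos, one_pow]
  linarith [show 0 < 4 * γ / (1 + γ) ^ 2 * (1 - ρ) ^ 2 by positivity]

/-- Every sector of a shell can be recentered so that distances to the origin shrink by the factor
`decayFactor γ ρ`. -/
theorem exists_norm_sub_sq_le {d : ℕ} {γ ρ r R : ℝ} (hγ : 0 < γ) (hρ : 0 ≤ ρ) (hρ1 : ρ < 1)
    (hr : 0 < r) (hR : γ * R ≤ r) (A : RSpace d ≃ₗᵢ[ℝ] RSpace d) :
    ∃ ν : RSpace d, ∀ ξ ∈ (A '' coneH d ρ) ∩ shell d r R,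
      ‖ξ - ν‖ ^ 2 ≤ decayFactor γ ρ ^ 2 * ‖ξ‖ ^ 2 := by
  have h1ρ : 0 < 1 - ρ := by linarith
  -- The harmonic mean of r and r/γ, the radii at which the quadratic `hquad` vanishes. The factor 1
  -- - ρ in the center lets (1 - ρ)² factor out of the cone estimate.
  set a := 2 * r / (1 + γ) with ha
  refine ⟨(a * (1 - ρ)) • A (diagonalVector d), ?_⟩
  rintro _ ⟨⟨x, ⟨-, hx⟩, rfl⟩, hsh⟩
  obtain ⟨hxR, hxr⟩ : ‖x‖ ≤ R ∧ r ≤ ‖x‖ := by simpa [shell] using hsh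
  rw [← map_smul, ← map_sub, A.norm_map, A.norm_map, norm_sub_sq_real, inner_smul_right, norm_smul,
    decayFactor_sq hγ hρ hρ1, Real.norm_of_nonneg (by positivity)]
  have hd : ‖diagonalVector d‖ ^ 2 ≤ 1 := pow_le_one₀ (norm_nonneg _) (norm_diagonalVector_le d)
  have hquad : a ^ 2 - 2 * a * ‖x‖ + 4 * γ / (1 + γ) ^ 2 * ‖x‖ ^ 2 ≤ 0 := by
    have : a ^ 2 - 2 * a * ‖x‖ + 4 * γ / (1 + γ) ^ 2 * ‖x‖ ^ 2 =
        -(4 / (1 + γ) ^ 2 * ((‖x‖ - r) * (r - γ * ‖x‖))) := by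
      rw [ha]
      field_simp
      ring
    rw [this, neg_nonpos]
    have : γ * ‖x‖ ≤ r := (mul_le_mul_of_nonneg_left hxR hγ.le).trans hR
    exact mul_nonneg (by positivity) (mul_nonneg (by linarith) (by linarith))
  have h1 : a * (1 - ρ) * ((1 - ρ) * ‖x‖) ≤ a * (1 - ρ) * inner ℝ x (diagonalVector d) := by
    gcongr
  have h2 : (a * (1 - ρ)) ^ 2 * ‖diagonalVector d‖ ^ 2 ≤ (a * (1 - ρ)) ^ 2 :=
    mul_le_of_le_one_right (by positivity) hd
  have h3 := mul_nonpos_of_nonneg_of_nonpos (sq_nonneg (1 - ρ)) hquad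
  rw [mul_pow]
  linarith

end Localization

/-! ### Propagation through the layers. -/

section Propagation

variable {d : ℕ} {ι : Type*} {χ : RSpace d → ℂ} {ψ : ι → RSpace d → ℂ}
  {κ : ℕ} {r : ℕ → ℝ} {γ ρ : ℝ}

theorem energyRemainder_succ (ψ : ι → RSpace d → ℂ) (N : ℕ) (f : RSpace d → ℂ) :
    energyRemainder ψ (N + 1) f = ∑' i, energyRemainder ψ N (singleStep (ψ i) f) := by
  unfold energyRemainder
  rw [← (Fin.consEquiv fun _ => ι).tsum_eq, ENNReal.tsum_prod']
  rfl

theorem energyRemainder_zero (ψ : ι → RSpace d → ℂ) (f : RSpace d → ℂ) :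
    energyRemainder ψ 0 f = eLpNorm f 2 volume ^ 2 := by
  simp [energyRemainder, scatteringPropagator]

theorem eLpNorm_singleStep (g f : RSpace d → ℂ) :
    eLpNorm (singleStep g f) 2 volume =
      eLpNorm (f ⋆[ContinuousLinearMap.mul ℂ ℂ, volume] g) 2 volume :=
  eLpNorm_congr_norm_ae (by simp [singleStep])

/-- The Littlewood-Paley condition bounds the total filtered energy. -/
theorem IsFilterBank.tsum_lintegral_le [Countable ι] (h : IsFilterBank χ ψ) {F : RSpace d → ℂ}
    (hF : AEStronglyMeasurable F volume) {w : RSpace d → ℝ≥0∞} (hw : Measurable w) :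
    ∑' i, ∫⁻ ξ, ‖F ξ‖ₑ ^ 2 * ‖𝓕 (ψ i) ξ‖ₑ ^ 2 * w ξ ≤ ∫⁻ ξ, ‖F ξ‖ₑ ^ 2 * w ξ := by
  have hψ : ∀ i, Continuous (𝓕 (ψ i)) := fun i =>
    Real.continuous_fourier_of_integrable (memLp_one_iff_integrable.1 (h.memL1 i))
  have hm : ∀ i, AEMeasurable (fun ξ => ‖F ξ‖ₑ ^ 2 * ‖𝓕 (ψ i) ξ‖ₑ ^ 2 * w ξ) volume := fun i =>
    ((hF.enorm.pow_const 2).mul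
      ((hψ i).measurable.enorm.pow_const 2).aemeasurable).mul hw.aemeasurable
  rw [← lintegral_tsum hm]
  refine lintegral_mono_ae ?_
  filter_upwards [h.littlewoodPaley] with ξ hξ
  rw [ENNReal.tsum_mul_right, ENNReal.tsum_mul_left]
  gcongr
  exact mul_le_of_le_one_right' (le_add_self.trans_eq hξ)

theorem FilterAssumption.gamma_le (h : FilterAssumption χ ψ κ r γ ρ) (j : ℕ) :
    γ ≤ r j / r (j + κ) := by
  rw [h.gamma_eq]
  refine ciInf_le ⟨0, ?_⟩ j
  rintro _ ⟨k, rfl⟩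
  exact (div_pos (h.scale_pos _) (h.scale_pos _)).le

theorem FilterAssumption.gamma_lt_one (h : FilterAssumption χ ψ κ r γ ρ) : γ < 1 := by
  refine (h.gamma_le 0).trans_lt ?_
  rw [div_lt_one (h.scale_pos _)]
  exact h.scale_strictMono (by linarith [h.two_le_kappa])

/-- One layer of the network contracts the high-pass energy at scale `t` to scale `t α²`. -/
theorem FilterAssumption.tsum_spectralEnergy_singleStep_le [Countable ι]
    (h : FilterAssumption χ ψ κ r γ ρ) {f : RSpace d → ℂ} (hf : MemLp f 2) {t : ℝ} (ht : 0 < t) :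
    ∃ hs : ∀ i, MemLp (singleStep (ψ i) f) 2,
      ∑' i, spectralEnergy (fun ξ => 1 - Real.exp (-(t * ‖ξ‖ ^ 2))) ((hs i).toLp _) ≤
        spectralEnergy (fun ξ => 1 - Real.exp (-(t * decayFactor γ ρ ^ 2 * ‖ξ‖ ^ 2)))
          (hf.toLp f) := by
  have hc := fun i => exists_fourier_convolution hf
    (memLp_one_iff_integrable.1 (h.filterBank.memL1 i)) (h.filterBank.memL2 i)
  refine ⟨fun i => (hc i).1.norm_ofReal, ?_⟩
  refine le_trans (ENNReal.tsum_le_tsum fun i => ?_) (h.filterBank.tsum_lintegral_le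
    (Lp.aestronglyMeasurable (𝓕 (hf.toLp f) : Lp ℂ 2 (volume : Measure (RSpace d))))
    (w := fun ξ => ENNReal.ofReal (1 - Real.exp (-(t * decayFactor γ ρ ^ 2 * ‖ξ‖ ^ 2))))
    (by fun_prop))
  obtain ⟨hci, hFc⟩ := hc i
  obtain ⟨J, hJ⟩ := h.localized
  obtain ⟨A, hA⟩ := hJ i
  obtain ⟨ν, hν⟩ := exists_norm_sub_sq_le h.gamma_pos h.rho_nonneg h.rho_lt_one
    (h.scale_pos (J i)) ((le_div_iff₀ (h.scale_pos _)).1 (h.gamma_le (J i))) A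
  refine (spectralEnergy_modulus_le hci ht ν).trans ?_
  refine lintegral_mono_ae ?_
  filter_upwards [hFc] with ξ hξ
  rw [hξ, enorm_mul, mul_pow, mul_comm (‖𝓕 (ψ i) ξ‖ₑ ^ 2)]
  -- The recentered bound is needed only where the filter is nonzero, hence inside its sector.
  rcases eq_or_ne (𝓕 (ψ i) ξ) 0 with h0 | h0
  · simp [h0]
  · have := hν ξ (hA (subset_tsupport _ h0))
    rw [mul_assoc t]
    gcongr

/-- Each filter vanishes for ‖ξ‖ < r 0; elsewhere the weight is at least 1 - exp(-t r₀²), whose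
inverse is the constant. -/
theorem FilterAssumption.energyRemainder_one_le [Countable ι]
    (h : FilterAssumption χ ψ κ r γ ρ) {f : RSpace d → ℂ} (hf : MemLp f 2) {t : ℝ} (ht : 0 < t) :
    energyRemainder ψ 1 f ≤ ENNReal.ofReal (1 - Real.exp (-(t * r 0 ^ 2)))⁻¹ *
      spectralEnergy (fun ξ => 1 - Real.exp (-(t * ‖ξ‖ ^ 2))) (hf.toLp f) := by
  have hr := h.scale_pos 0
  have hc : 0 < 1 - Real.exp (-(t * r 0 ^ 2)) := by
    rw [sub_pos, Real.exp_lt_one_iff]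
    have : 0 < t * r 0 ^ 2 := by positivity
    linarith
  simp only [energyRemainder_succ, energyRemainder_zero, eLpNorm_singleStep,
    eLpNorm_convolution_sq hf (memLp_one_iff_integrable.1 (h.filterBank.memL1 _))
      (h.filterBank.memL2 _)]
  refine le_trans ?_ (mul_le_mul_right (h.filterBank.tsum_lintegral_le
    (Lp.aestronglyMeasurable (𝓕 (hf.toLp f) : Lp ℂ 2 (volume : Measure (RSpace d))))
    (w := fun ξ => ENNReal.ofReal (1 - Real.exp (-(t * ‖ξ‖ ^ 2)))) (by fun_prop)) _)
  rw [← ENNReal.tsum_mul_left]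
  refine ENNReal.tsum_le_tsum fun i => ?_
  rw [← lintegral_const_mul' _ _ ENNReal.ofReal_ne_top]
  refine lintegral_mono fun ξ => ?_
  rcases eq_or_ne (𝓕 (ψ i) ξ) 0 with h0 | h0
  · simp [h0]
  · obtain ⟨J, hJ⟩ := h.localized
    obtain ⟨A, hA⟩ := hJ i
    have hsh := (hA (subset_tsupport _ h0)).2
    have hξ : r 0 ≤ ‖ξ‖ := by
      refine (h.scale_strictMono.monotone (Nat.zero_le (J i))).trans ?_
      simpa using hsh.2
    dsimp only
    rw [mul_left_comm, ← ENNReal.ofReal_mul (by positivity)]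
    refine le_mul_of_one_le_right' ?_
    rw [ENNReal.one_le_ofReal, inv_mul_eq_div, one_le_div hc]
    gcongr

/-- Peel off the first filter, use the induction hypothesis at the same t on each output, then
contract once more. The constant does not grow with N because the lower bound on the weight is used
only in the last layer. -/
theorem FilterAssumption.energyRemainder_succ_le [Countable ι]
    (h : FilterAssumption χ ψ κ r γ ρ) {t : ℝ} (ht : 0 < t) (N : ℕ) {f : RSpace d → ℂ}
    (hf : MemLp f 2) :
    energyRemainder ψ (N + 1) f ≤ ENNReal.ofReal (1 - Real.exp (-(t * r 0 ^ 2)))⁻¹ *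
      spectralEnergy (fun ξ => 1 - Real.exp (-(t * decayFactor γ ρ ^ (2 * N) * ‖ξ‖ ^ 2)))
        (hf.toLp f) := by
  induction N generalizing f with
  | zero => simpa using h.energyRemainder_one_le hf ht
  | succ N ih =>
    have hα := decayFactor_pos h.gamma_pos h.gamma_lt_one h.rho_nonneg h.rho_lt_one
    obtain ⟨hs, hle⟩ := h.tsum_spectralEnergy_singleStep_le hf
      (t := t * decayFactor γ ρ ^ (2 * N)) (by positivity)
    rw [energyRemainder_succ, mul_add_one, pow_add, ← mul_assoc]
    refine (ENNReal.tsum_le_tsum fun i => ih (hs i)).trans ?_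
    rw [ENNReal.tsum_mul_left]
    gcongr

/-- M depends only on f and ω, so one constant serves the weights of all depths N. -/
theorem exists_spectralEnergy_le_of_mem_fourierWeightedL2 {ω : ℝ → ℝ}
    {f : Lp ℂ 2 (volume : Measure (RSpace d))} (hf : f ∈ fourierWeightedL2 d ω) :
    ∃ M : ℝ, 0 < M ∧ ∀ (w : RSpace d → ℝ) (K : ℝ), 0 ≤ K → (∀ ξ, w ξ ≤ K * ω ‖ξ‖ ^ 2) →
      spectralEnergy w f ≤ ENNReal.ofReal (K * M) := by
  have hf' : MemLp (fun ξ : RSpace d =>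
    (ω ‖ξ‖ : ℂ) * (𝓕 f : Lp ℂ 2 (volume : Measure (RSpace d))) ξ) 2 volume := hf
  have hfin := ENNReal.pow_ne_top (n := 2) hf'.eLpNorm_ne_top
  refine ⟨(eLpNorm (fun ξ : RSpace d =>
    (ω ‖ξ‖ : ℂ) * (𝓕 f : Lp ℂ 2 (volume : Measure (RSpace d))) ξ) 2 volume ^ 2).toReal + 1,
    by positivity, fun w K hK hw => ?_⟩
  rw [ENNReal.ofReal_mul hK]
  refine le_trans ?_ (mul_le_mul_right (ENNReal.ofReal_le_ofReal (le_add_of_nonneg_right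
    zero_le_one)) _)
  rw [ENNReal.ofReal_toReal hfin]
  rw [eLpNorm_two_sq_eq_lintegral, ← lintegral_const_mul' _ _ ENNReal.ofReal_ne_top]
  refine lintegral_mono fun ξ => ?_
  dsimp only
  rw [enorm_mul, mul_pow, mul_comm, ← mul_assoc]
  gcongr
  rw [← ofReal_norm, Complex.norm_real, ← ENNReal.ofReal_pow (norm_nonneg _),
    ← ENNReal.ofReal_mul hK, Real.norm_eq_abs, sq_abs]
  exact ENNReal.ofReal_le_ofReal (hw ξ)

end Propagation

theorem mainTheorem9 {d : ℕ} (hd : 1 ≤ d) {ι : Type*} [Countable ι]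
    (χ : RSpace d → ℂ) (ψ : ι → RSpace d → ℂ) (κ : ℕ) (r : ℕ → ℝ) (γ ρ : ℝ)
    (h : FilterAssumption χ ψ κ r γ ρ) :
    (0 < decayFactor γ ρ ∧ decayFactor γ ρ < 1) ∧
    (∀ s : ℝ, 0 < s → ∀ f ∈ sobolevH d s,
      ∃ C : ℝ, 0 < C ∧ ∃ N₀ : ℕ, ∀ N : ℕ, N₀ ≤ N →
        energyRemainder ψ N f ≤
          ENNReal.ofReal (C * decayFactor γ ρ ^ (2 * min s 1 * (N : ℝ)))) ∧
    (∀ s : ℝ, 0 < s → ∀ f ∈ logSobolevH d s,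
      ∃ C : ℝ, 0 < C ∧ ∃ N₀ : ℕ, ∀ N : ℕ, N₀ ≤ N →
        energyRemainder ψ N f ≤ ENNReal.ofReal (C * (N : ℝ) ^ (-(2 * s)))) := by
  have hα := decayFactor_pos h.gamma_pos h.gamma_lt_one h.rho_nonneg h.rho_lt_one
  have hα1 := decayFactor_lt_one h.gamma_pos h.rho_lt_one
  have hr := h.scale_pos 0
  have hc : 0 < (1 - Real.exp (-(1 * r 0 ^ 2)))⁻¹ := by
    rw [inv_pos, sub_pos, Real.exp_lt_one_iff]
    have : 0 < 1 * r 0 ^ 2 := by positivity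
    linarith
  have hW := fun (N : ℕ) (f : Lp ℂ 2 (volume : Measure (RSpace d))) =>
    h.energyRemainder_succ_le one_pos N (Lp.memLp f)
  simp only [Lp.toLp_coeFn, one_mul] at hW hc
  set c := (1 - Real.exp (-(r 0 ^ 2)))⁻¹
  set α := decayFactor γ ρ
  refine ⟨⟨hα, hα1⟩, fun s hs f hf => ?_, fun s hs f hf => ?_⟩
  · obtain ⟨M, hM, hMle⟩ := exists_spectralEnergy_le_of_mem_fourierWeightedL2 hf
    -- The extra power of α compensates for only N - 1 contractions in N layers.
    refine ⟨c * M * α ^ (-(2 * min s 1)), by positivity, 1, fun N hN => ?_⟩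
    obtain ⟨n, rfl⟩ := Nat.exists_eq_add_of_le' hN
    refine (hW n f).trans ((mul_le_mul_right (hMle _ (α ^ (2 * min s 1 * (n : ℝ))) (by positivity)
      fun ξ => one_sub_exp_le_sobolev hα hs n ‖ξ‖) _).trans_eq ?_)
    rw [← ENNReal.ofReal_mul hc.le]
    congr 1
    rw [mul_assoc (c * M), ← Real.rpow_add hα, Nat.cast_add_one,
      show -(2 * min s 1) + 2 * min s 1 * ((n : ℝ) + 1) = 2 * min s 1 * n by ring]
    ring
  · obtain ⟨M, hM, hMle⟩ := exists_spectralEnergy_le_of_mem_fourierWeightedL2 hf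
    obtain ⟨K, hK, hKle⟩ := exists_one_sub_exp_le_logSobolev hα hα1 hs
    -- The weight bound already carries n + 1 = N, so no shift correction is needed. N = 0 is
    -- excluded: there the real power on the right is 0.
    refine ⟨c * M * K, by positivity, 1, fun N hN => ?_⟩
    obtain ⟨n, rfl⟩ := Nat.exists_eq_add_of_le' hN
    refine (hW n f).trans ((mul_le_mul_right (hMle _ (K * ((n : ℝ) + 1) ^ (-(2 * s)))
      (by positivity) fun ξ => hKle n ‖ξ‖ (norm_nonneg ξ)) _).trans_eq ?_)
    rw [← ENNReal.ofReal_mul hc.le]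
    congr 1
    rw [Nat.cast_add_one]
    ring
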